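/- \textbf{Setting.} Let $X=L^2_{\mathbb C}(0,1)$, $Y=L^2_{\mathbb C}(0,2)$, $X_0=H^1_{\mathbb C}(0,1)$, and $\mathfrak P=\{(s,\tau)\in[0,2]\times[0,1]:\ \tau\le s\le\tau+1\}$. Let $k:\mathbb R^2\to\mathbb C$ satisfy $\operatorname{supp}k\subset\mathfrak P$, $k\in C(\mathfrak P)$ and $k(s,\tau)=k(s,s-\tau)$ for $(s,\tau)\in\mathfrak P$, and define $F:X\to Y$ by $$[F(f)](s)=\int_{\max(s-1,0)}^{\min(s,1)}k(s,\tau)\,f(s-\tau)\,f(\tau)\,d\tau ,\qquad 0\le s\le 2 .$$ For $\varepsilon>0$ and $g\in Y$ put $[\mathrm{Sign}_\varepsilon(g)](s)=g(s)/\max(\varepsilon,|g(s)|)$, and let $|f|\in L^2(0,1)$ denote the pointwise modulus of $f\in X$. Let $\mathcal R:X_0\to(-\infty,\infty]$ be \emph{stabilizing}, i.e. proper, weakly sequentially lower semicontinuous, and such that every sequence in a sublevel set $\{\mathcal R\le M\}$, $M\in\mathbb R$, has a subsequence converging weakly in $X_0$. Fix $\varepsilon,\beta>0$. For $\alpha>0$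 and data $(y,a)\in Y\times L^2(0,1)$ (with $L^2(0,1)$ real-valued) consider on $X_0$ $$\mathcal T_{\alpha}(f;y,a)=\tfrac12\|\mathrm{Sign}_\varepsilon(F(f))-y\|_Y^2+\tfrac\beta2\||f|-a\|_{L^2(0,1)}^2+\alpha\,\mathcal R(f).$$ The phase retrieval functional with data $\psi^\delta\in L^2(0,2)$ (real-valued), $a^\sigma\in L^2(0,1)$ is $\mathcal T_\alpha(f;e^{i\psi^\delta},a^\sigma)$. \textbf{Proposition.} Minimizing $\mathcal T_\alpha$ over $X_0$ is well-posed in the following sense. (1) \emph{Existence.} For all $\alpha>0$, $\psi^\delta\in L^2(0,2)$ and $a^\sigma\in L^2(0,1)$ the functional $\mathcal T_\alpha(\,\cdot\,;e^{i\psi^\delta},a^\sigma)$ has a minimizer in $X_0$. More generally $\mathcal T_\alpha(\,\cdot\,;y,a)$ has a minimizer for every $(y,a)\in Y\times L^2(0,1)$. (2) \emph{Stability.} Let $\alpha>0$, let $y_n\to y$ in $Y$ and $a_n\to a$ in $L^2(0,1)$, and let $f_n$ be a minimizer of $\mathcal T_\alpha(\,\cdot\,;y_n,a_n)$ for each $n$.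 Then $(f_n)$ has a subsequence that converges weakly in $X_0$; and whenever a subsequence $f_{n_j}\rightharpoonup f$ in $X_0$, the limit $f$ is a minimizer of $\mathcal T_\alpha(\,\cdot\,;y,a)$ and $\mathcal R(f_{n_j})\to\mathcal R(f)$. In particular this holds for $y_n=e^{i\psi_n}$, $y=e^{i\psi}$ with $\psi_n,\psi\in L^2(0,2)$ and $\|e^{i\psi_n}-e^{i\psi}\|_Y\to0$. (3) \emph{Convergence.} Let $(y,a)\in Y\times L^2(0,1)$ be exact data for which there is $f\in X_0$ with $\mathrm{Sign}_\varepsilon(F(f))=y$, $|f|=a$ and $\mathcal R(f)<\infty$. Then there is an $\mathcal R$-minimizing solution, i.e. one which minimizes $\mathcal R$ among all such solutions and has finite $\mathcal R$-value. Let $\|y_n-y\|_Y\le\delta_n$, $\|a_n-a\|_{L^2(0,1)}\le\sigma_n$, $\alpha_n>0$, with $\delta_n\to0$, $\sigma_n\to0$, $\alpha_n\to0$ and $(\delta_n^2+\sigma_n^2)/\alpha_n\to0$, and let $f_n$ be a minimizer of $\mathcal T_{\alpha_n}(\,\cdot\,;y_n,a_n)$ for each $n$. Then $(f_n)$ has a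 subsequence that converges weakly in $X_0$; whenever a subsequence $f_{n_j}\rightharpoonup f$ in $X_0$, the limit $f$ is an $\mathcal R$-minimizing solution and $\mathcal R(f_{n_j})\to\mathcal R(f)$; and if the $\mathcal R$-minimizing solution $f^\dagger$ is unique, then $f_n\rightharpoonup f^\dagger$ in $X_0$ for the whole sequence. -/

import Mathlib

open MeasureTheory Filter Topology Set
open scoped ENNReal ContDiff

noncomputable section

namespace PhaseRetrieval

/-! ## The spaces -/

/-- Lebesgue measure on the interval `(0,1)`. -/
abbrev vol01 : Measure ℝ := volume.restrict (Ioo (0 : ℝ) 1)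

/-- Lebesgue measure on the interval `(0,2)`. -/
abbrev vol02 : Measure ℝ := volume.restrict (Ioo (0 : ℝ) 2)

/-- `X = L²_ℂ(0,1)`. -/
abbrev X : Type := Lp ℂ 2 vol01

/-- `Y = L²_ℂ(0,2)`. -/
abbrev Y : Type := Lp ℂ 2 vol02

/-- `L²(0,1)`, real-valued. -/
abbrev RealL201 : Type := Lp ℝ 2 vol01

/-- `L²(0,2)`, real-valued. -/
abbrev RealL202 : Type := Lp ℝ 2 vol02

/-- `g` is the weak derivative of `f` on `(0,1)`: `∫ f φ' = - ∫ g φ` for every smooth `φ` with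
compact support in `(0,1)`. -/
def IsWeakDeriv (f g : X) : Prop :=
  ∀ φ : ℝ → ℝ, ContDiff ℝ ∞ φ → HasCompactSupport φ → tsupport φ ⊆ Ioo 0 1 →
    ∫ x in Ioo (0 : ℝ) 1, deriv φ x • f x = - ∫ x in Ioo (0 : ℝ) 1, φ x • g x

theorem integrable_smul_L2 (f : X) (ψ : ℝ → ℝ) (hψ : Continuous ψ) (hc : HasCompactSupport ψ) :
    Integrable (fun x => ψ x • f x) vol01 := by
  have hf : Integrable f vol01 := (Lp.memLp f).integrable (by norm_num)
  obtain ⟨C, hC⟩ := hc.exists_bound_of_continuous hψ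
  exact hf.bdd_smul C hψ.aestronglyMeasurable (Eventually.of_forall hC)

theorem IsWeakDeriv.add {f₁ g₁ f₂ g₂ : X} (h₁ : IsWeakDeriv f₁ g₁) (h₂ : IsWeakDeriv f₂ g₂) :
    IsWeakDeriv (f₁ + f₂) (g₁ + g₂) := by
  intro φ hφ hc hs
  have hd : Continuous (deriv φ) := hφ.continuous_deriv (by simp)
  have e₁ : ∫ x in Ioo (0 : ℝ) 1, deriv φ x • (f₁ + f₂ : X) x
      = (∫ x in Ioo (0 : ℝ) 1, deriv φ x • f₁ x) + ∫ x in Ioo (0 : ℝ) 1, deriv φ x • f₂ x := by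
    rw [← integral_add (integrable_smul_L2 f₁ _ hd hc.deriv) (integrable_smul_L2 f₂ _ hd hc.deriv)]
    refine integral_congr_ae ?_
    filter_upwards [Lp.coeFn_add f₁ f₂] with x hx
    rw [hx, Pi.add_apply, smul_add]
  have e₂ : ∫ x in Ioo (0 : ℝ) 1, φ x • (g₁ + g₂ : X) x
      = (∫ x in Ioo (0 : ℝ) 1, φ x • g₁ x) + ∫ x in Ioo (0 : ℝ) 1, φ x • g₂ x := by
    rw [← integral_add (integrable_smul_L2 g₁ _ hφ.continuous hc)
      (integrable_smul_L2 g₂ _ hφ.continuous hc)]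
    refine integral_congr_ae ?_
    filter_upwards [Lp.coeFn_add g₁ g₂] with x hx
    rw [hx, Pi.add_apply, smul_add]
  rw [e₁, e₂, h₁ φ hφ hc hs, h₂ φ hφ hc hs, neg_add]

theorem IsWeakDeriv.smul {f g : X} (c : ℂ) (h : IsWeakDeriv f g) :
    IsWeakDeriv (c • f) (c • g) := by
  intro φ hφ hc hs
  have e : ∀ (ψ : ℝ → ℝ) (u : X), ∫ x in Ioo (0 : ℝ) 1, ψ x • (c • u : X) x
      = c • ∫ x in Ioo (0 : ℝ) 1, ψ x • u x := by
    intro ψ u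
    rw [← integral_smul]
    refine integral_congr_ae ?_
    filter_upwards [Lp.coeFn_smul c u] with x hx
    rw [hx, Pi.smul_apply, smul_comm]
  rw [e, e, h φ hφ hc hs, smul_neg]

/-- `X₀ = H¹_ℂ(0,1)`, realised as the space of pairs `(f, f')` of a function `f ∈ L²_ℂ(0,1)` and
its weak derivative `f' ∈ L²_ℂ(0,1)`, with the inner product inherited from `L² × L²`, that is,
with norm `‖f‖² + ‖f'‖²` squared. As the weak derivative of `f` is unique, such a pair is the
same thing as the function `f`. -/
def H1 : Submodule ℂ (WithLp 2 (X × X)) where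
  carrier := {p | IsWeakDeriv p.fst p.snd}
  add_mem' h₁ h₂ := h₁.add h₂
  zero_mem' := by
    intro φ _ _ _
    have e : ∀ ψ : ℝ → ℝ, ∫ x in Ioo (0 : ℝ) 1, ψ x • (0 : X) x = 0 := by
      intro ψ
      rw [integral_eq_zero_of_ae]
      filter_upwards [Lp.coeFn_zero ℂ 2 vol01] with x hx
      rw [hx, Pi.zero_apply, smul_zero]
    change ∫ x in Ioo (0 : ℝ) 1, deriv φ x • (0 : X) x = - ∫ x in Ioo (0 : ℝ) 1, φ x • (0 : X) x
    rw [e, e, neg_zero]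
  smul_mem' c _ h := h.smul c

/-- The embedding `H¹_ℂ(0,1) → L²_ℂ(0,1)`. -/
def toX (f : H1) : X := f.1.fst

/-! ## The autoconvolution operator -/

/-- The parallelogram `{(s, τ) ∈ [0,2] × [0,1] : τ ≤ s ≤ τ + 1}`. -/
def parallelogram : Set (ℝ × ℝ) :=
  {p | p.1 ∈ Icc (0 : ℝ) 2 ∧ p.2 ∈ Icc (0 : ℝ) 1 ∧ p.2 ≤ p.1 ∧ p.1 ≤ p.2 + 1}

/-- The standing assumption on the kernel: `k` is supported in the parallelogram, is continuous
on it, and satisfies `k(s,τ) = k(s,s-τ)` there. -/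
structure IsKernel (k : ℝ → ℝ → ℂ) : Prop where
  support_subset : tsupport (fun p : ℝ × ℝ => k p.1 p.2) ⊆ parallelogram
  continuousOn : ContinuousOn (fun p : ℝ × ℝ => k p.1 p.2) parallelogram
  symm : ∀ s τ : ℝ, (s, τ) ∈ parallelogram → k s τ = k s (s - τ)

/-- The kernel-based autoconvolution, pointwise:
`[F(f)](s) = ∫_{max(s-1,0)}^{min(s,1)} k(s,τ) f(s-τ) f(τ) dτ`. For `0 < s < 2` only the values
of `f` on `(0,1)` matter, up to null sets. -/
def autoconvFun (k : ℝ → ℝ → ℂ) (f : ℝ → ℂ) (s : ℝ) : ℂ :=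
  ∫ τ in (max (s - 1) 0)..(min s 1), k s τ * f (s - τ) * f τ

theorem isClosed_parallelogram : IsClosed parallelogram :=
  (isClosed_Icc.preimage continuous_fst).inter ((isClosed_Icc.preimage continuous_snd).inter
    ((isClosed_le continuous_snd continuous_fst).inter
      (isClosed_le continuous_fst (continuous_snd.add continuous_const))))

theorem isCompact_parallelogram : IsCompact parallelogram :=
  (isCompact_Icc.prod isCompact_Icc : IsCompact (Icc (0 : ℝ) 2 ×ˢ Icc (0 : ℝ) 1)).of_isClosed_subset
    isClosed_parallelogram (fun _ hp => ⟨hp.1, hp.2.1⟩)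

theorem IsKernel.eq_zero {k : ℝ → ℝ → ℂ} (hk : IsKernel k) {s τ : ℝ}
    (h : (s, τ) ∉ parallelogram) : k s τ = 0 := by
  by_contra hne
  exact h (hk.support_subset (subset_tsupport _ hne))

theorem IsKernel.measurable {k : ℝ → ℝ → ℂ} (hk : IsKernel k) :
    Measurable (fun p : ℝ × ℝ => k p.1 p.2) := by
  classical
  have e : (fun p : ℝ × ℝ => k p.1 p.2)
      = parallelogram.piecewise (fun p : ℝ × ℝ => k p.1 p.2) (fun _ => 0) := by
    ext p
    by_cases hp : p ∈ parallelogram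
    · rw [Set.piecewise_eq_of_mem _ _ _ hp]
    · rw [Set.piecewise_eq_of_notMem _ _ _ hp]
      exact hk.eq_zero hp
  rw [e]
  exact hk.continuousOn.measurable_piecewise continuousOn_const
    isClosed_parallelogram.measurableSet

theorem IsKernel.exists_bound {k : ℝ → ℝ → ℂ} (hk : IsKernel k) :
    ∃ C : ℝ, 0 ≤ C ∧ ∀ s τ, ‖k s τ‖ ≤ C := by
  obtain ⟨C, hC⟩ := isCompact_parallelogram.exists_bound_of_continuousOn hk.continuousOn
  refine ⟨max C 0, le_max_right _ _, fun s τ => ?_⟩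
  by_cases hp : (s, τ) ∈ parallelogram
  · exact (hC _ hp).trans (le_max_left _ _)
  · rw [hk.eq_zero hp, norm_zero]
    exact le_max_right _ _

theorem memLp_autoconvFun {k : ℝ → ℝ → ℂ} (hk : IsKernel k) (f : X) :
    MemLp (autoconvFun k f) 2 vol02 := by
  obtain ⟨C, hC0, hC⟩ := hk.exists_bound
  have hfm : Measurable (f : ℝ → ℂ) := (Lp.stronglyMeasurable f).measurable
  let S : Set (ℝ × ℝ) := {p | p.2 ∈ Ioc (max (p.1 - 1) 0) (min p.1 1)}
  have hS : MeasurableSet S :=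
    (measurableSet_lt (by fun_prop) measurable_snd).inter
      (measurableSet_le measurable_snd (by fun_prop))
  let G : ℝ × ℝ → ℂ := S.indicator fun p => k p.1 p.2 * f (p.1 - p.2) * f p.2
  have hG : Measurable G := by
    refine Measurable.indicator ?_ hS
    exact (hk.measurable.mul (hfm.comp (measurable_fst.sub measurable_snd))).mul
      (hfm.comp measurable_snd)
  have hconv : ∀ s ∈ Ioo (0 : ℝ) 2, autoconvFun k f s = ∫ τ, G (s, τ) := by
    intro s hs
    have hle : max (s - 1) 0 ≤ min s 1 := by
      have := hs.1
      have := hs.2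
      exact max_le (le_min (by linarith) (by linarith)) (le_min (by linarith) (by linarith))
    rw [autoconvFun, intervalIntegral.integral_of_le hle, ← integral_indicator measurableSet_Ioc]
    rfl
  let h : ℝ → ℝ := (Icc (0 : ℝ) 1).indicator fun τ => ‖f τ‖ ^ 2
  have hh : Integrable h := by
    refine IntegrableOn.integrable_indicator ?_ measurableSet_Icc
    rw [integrableOn_Icc_iff_integrableOn_Ioo]
    exact (Lp.memLp f).integrable_norm_pow (by norm_num)
  have hb : ∀ s τ, ‖G (s, τ)‖ ≤ C * (h (s - τ) + h τ) := by
    intro s τ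
    have hnn : ∀ t, 0 ≤ h t := fun t => Set.indicator_nonneg (fun _ _ => by positivity) t
    by_cases hp : (s, τ) ∈ S
    · have hp' : τ ∈ Ioc (max (s - 1) 0) (min s 1) := hp
      simp only [mem_Ioc, max_lt_iff, le_min_iff] at hp'
      have m₁ : s - τ ∈ Icc (0 : ℝ) 1 := ⟨by linarith, by linarith⟩
      have m₂ : τ ∈ Icc (0 : ℝ) 1 := ⟨by linarith, by linarith⟩
      simp only [G, h, Set.indicator_of_mem hp, Set.indicator_of_mem m₁, Set.indicator_of_mem m₂]
      rw [mul_assoc, norm_mul, norm_mul]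
      refine mul_le_mul (hC s τ) ?_ (by positivity) hC0
      nlinarith [sq_nonneg (‖f (s - τ)‖ - ‖f τ‖), sq_nonneg ‖f (s - τ)‖, sq_nonneg ‖f τ‖]
    · simp only [G, Set.indicator_of_notMem hp, norm_zero]
      have := hnn (s - τ)
      have := hnn τ
      positivity
  refine MemLp.of_bound ?_ (C * (∫ τ, h τ + h τ)) ?_
  · refine AEStronglyMeasurable.congr (f := fun s => ∫ τ, G (s, τ)) ?_ ?_
    · exact (hG.stronglyMeasurable.integral_prod_right' (ν := volume)).aestronglyMeasurable
    · filter_upwards [ae_restrict_mem measurableSet_Ioo] with s hs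
      exact (hconv s hs).symm
  · filter_upwards [ae_restrict_mem measurableSet_Ioo] with s hs
    rw [hconv s hs]
    refine (norm_integral_le_of_norm_le
      (((hh.comp_sub_left s).add hh).const_mul C) (Eventually.of_forall (hb s))).trans ?_
    rw [integral_const_mul, integral_add hh hh]
    simp only [Pi.add_apply]
    rw [integral_add (hh.comp_sub_left s) hh, integral_sub_left_eq_self h volume s]

/-- The autoconvolution operator `F : L²_ℂ(0,1) → L²_ℂ(0,2)`. -/
def autoconv (k : ℝ → ℝ → ℂ) (hk : IsKernel k) (f : X) : Y :=
  (memLp_autoconvFun hk f).toLp (autoconvFun k f)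

/-! ## The phase retrieval operator and the Tikhonov functional -/

/-- `z ↦ z / max(ε, |z|)`. -/
def signFun (ε : ℝ) (z : ℂ) : ℂ := z / ((max ε ‖z‖ : ℝ) : ℂ)

theorem memLp_signFun (ε : ℝ) (g : Y) : MemLp (fun s => signFun ε (g s)) 2 vol02 := by
  have hm : Measurable (signFun ε) := by
    unfold signFun
    fun_prop
  refine MemLp.of_bound (hm.comp (Lp.stronglyMeasurable g).measurable).aestronglyMeasurable 1
    (Eventually.of_forall fun s => ?_)
  have h0 : 0 ≤ max ε ‖g s‖ := (norm_nonneg _).trans (le_max_right _ _)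
  rw [signFun, norm_div, Complex.norm_real, Real.norm_of_nonneg h0]
  exact div_le_one_of_le₀ (le_max_right _ _) h0

/-- The regularised sign operator `[Sign_ε(g)](s) = g(s) / max(ε, |g(s)|)` on `L²_ℂ(0,2)`. -/
def signOp (ε : ℝ) (g : Y) : Y := (memLp_signFun ε g).toLp (fun s => signFun ε (g s))

/-- The pointwise modulus `|f| ∈ L²(0,1)` of `f ∈ L²_ℂ(0,1)`. -/
def modulus (f : X) : RealL201 := (Lp.memLp f).norm.toLp (fun τ => ‖f τ‖)

theorem memLp_expPhase (ψ : RealL202) :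
    MemLp (fun s => Complex.exp (Complex.I * (ψ s : ℂ))) 2 vol02 := by
  have hψ : Measurable (ψ : ℝ → ℝ) := (Lp.stronglyMeasurable ψ).measurable
  refine MemLp.of_bound (Measurable.aestronglyMeasurable (by fun_prop)) 1
    (Eventually.of_forall fun s => ?_)
  rw [mul_comm, Complex.norm_exp_ofReal_mul_I]

/-- The function `e^{iψ} ∈ L²_ℂ(0,2)` for a real phase function `ψ ∈ L²(0,2)`. -/
def expPhase (ψ : RealL202) : Y :=
  (memLp_expPhase ψ).toLp (fun s => Complex.exp (Complex.I * (ψ s : ℂ)))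

/-- The Tikhonov functional for data `(y, a)` in the data space `L²_ℂ(0,2) × L²(0,1)`:
`½ ‖Sign_ε(F(f)) - y‖² + (β/2) ‖|f| - a‖² + α R(f)` for `f ∈ H¹_ℂ(0,1)`. -/
def tikhonov (k : ℝ → ℝ → ℂ) (hk : IsKernel k) (R : H1 → EReal) (ε β α : ℝ) (y : Y)
    (a : RealL201) (f : H1) : EReal :=
  ((1 / 2 * ‖signOp ε (autoconv k hk (toX f)) - y‖ ^ 2
    + β / 2 * ‖modulus (toX f) - a‖ ^ 2 : ℝ) : EReal) + (α : EReal) * R f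

/-- The Tikhonov functional of the phase retrieval problem, with phase data `ψ` and amplitude
data `a`: `½ ‖Sign_ε(F(f)) - e^{iψ}‖² + (β/2) ‖|f| - a‖² + α R(f)`. -/
def phaseTikhonov (k : ℝ → ℝ → ℂ) (hk : IsKernel k) (R : H1 → EReal) (ε β α : ℝ)
    (ψ : RealL202) (a : RealL201) (f : H1) : EReal :=
  tikhonov k hk R ε β α (expPhase ψ) a f

/-- `f` minimizes the functional `T` over all of `H¹_ℂ(0,1)`. -/
def IsMinimizer (T : H1 → EReal) (f : H1) : Prop := IsMinOn T univ f

/-- `u n ⇀ f` weakly in `H¹_ℂ(0,1)`. -/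
def WeakTendsto (u : ℕ → H1) (f : H1) : Prop :=
  Tendsto (fun n => toWeakSpace ℂ H1 (u n)) atTop (𝓝 (toWeakSpace ℂ H1 f))

/-- A penalty `R : H¹_ℂ(0,1) → (-∞, ∞]` is stabilizing if it is proper, weakly sequentially lower
semicontinuous, and has weakly sequentially precompact sublevel sets. -/
structure IsStabilizing (R : H1 → EReal) : Prop where
  ne_bot : ∀ f, R f ≠ ⊥
  exists_ne_top : ∃ f, R f ≠ ⊤
  lsc : ∀ (u : ℕ → H1) (f : H1), WeakTendsto u f → R f ≤ liminf (fun n => R (u n)) atTop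
  precompact : ∀ (M : ℝ) (u : ℕ → H1), (∀ n, R (u n) ≤ (M : EReal)) →
    ∃ (φ : ℕ → ℕ) (f : H1), StrictMono φ ∧ WeakTendsto (u ∘ φ) f

/-- `f` solves the regularised phase retrieval equation
`Sign_ε(F(f)) = y`, `|f| = a`, with exact data `(y, a)`. -/
def IsSolution (k : ℝ → ℝ → ℂ) (hk : IsKernel k) (ε : ℝ) (y : Y) (a : RealL201) (f : H1) : Prop :=
  signOp ε (autoconv k hk (toX f)) = y ∧ modulus (toX f) = a

/-- `f` is an `R`-minimizing solution for the exact data `(y, a)`: a solution with `R f < ∞` and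
`R f ≤ R g` for every solution `g`. -/
def IsRMinimizingSolution (k : ℝ → ℝ → ℂ) (hk : IsKernel k) (R : H1 → EReal) (ε : ℝ) (y : Y)
    (a : RealL201) (f : H1) : Prop :=
  IsSolution k hk ε y a f ∧ R f ≠ ⊤ ∧ ∀ g, IsSolution k hk ε y a g → R f ≤ R g

end PhaseRetrieval

end

open PhaseRetrieval

noncomputable section

namespace PhaseRetrieval

/-! Everything rests on one fact: both forward maps, `f ↦ Sign_ε(F(f))` and `f ↦ |f|`, send weakly
convergent sequences of `H¹(0,1)` to norm convergent ones in `L²`. By `exists_evaluation`, point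
values of `H¹` functions are a.e. given by functionals of uniformly bounded norm, so weak
convergence forces boundedness and a.e. convergence. Dominated convergence carries this through the
autoconvolution integral; `Sign_ε` is continuous with values in the unit disc, so bounded
convergence finishes.

The misfit is then continuous jointly in the data (norm) and the argument (weak), and the rest is
Tikhonov theory. Minimality of `f` means `R f ≤ R g + (misfit g - misfit f) / α` for all `g`
(`isMinimizer_tikhonov_iff`). Such bounds pass to weak limits by lower semicontinuity of `R`; with
`g` the weak limit itself they also give convergence of the penalties. If `g` is an exact solution,
its misfit is of order `δ² + σ²`, which is negligible against `α`. Subsequences come from the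
sublevel sets of `R`, minimizers from the direct method `exists_isMinOn`. -/

/-! ## Point evaluation on `H¹(0,1)` -/

/-- A smooth function of mean zero with compact support in `(a,b)` has a primitive with compact
support in `(a,b)`. -/
theorem primitive_testFunction {ζ : ℝ → ℝ} {a b : ℝ} (hζ : ContDiff ℝ ∞ ζ)
    (hc : HasCompactSupport ζ) (hs : tsupport ζ ⊆ Ioo a b) (h0 : ∫ x in a..b, ζ x = 0) :
    ContDiff ℝ ∞ (fun x => ∫ t in a..x, ζ t) ∧
      (deriv (fun x => ∫ t in a..x, ζ t)) = ζ ∧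
      HasCompactSupport (fun x => ∫ t in a..x, ζ t) ∧
      tsupport (fun x => ∫ t in a..x, ζ t) ⊆ Ioo a b := by
  have hd : ∀ x, HasDerivAt (fun x => ∫ t in a..x, ζ t) (ζ x) x := fun x =>
    hζ.continuous.integral_hasStrictDerivAt a x |>.hasDerivAt
  have hderiv : deriv (fun x => ∫ t in a..x, ζ t) = ζ := funext fun x => (hd x).deriv
  have hii : ∀ u v, IntervalIntegrable ζ volume u v := fun u v => hζ.continuous.intervalIntegrable u v
  -- An empty support has no extreme points `c`, `d`, so `ζ = 0` is treated separately.
  obtain ⟨c, d, ⟨hcd, hac, hdb⟩ | h⟩ :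
      ∃ c d, (tsupport ζ ⊆ Icc c d ∧ a < c ∧ d < b) ∨ ∀ x, ζ x = 0 := by
    rcases (tsupport ζ).eq_empty_or_nonempty with he | hne
    · exact ⟨0, 0, Or.inr fun x => by
        by_contra hx
        exact (he ▸ subset_tsupport ζ hx : x ∈ (∅ : Set ℝ))⟩
    · obtain ⟨c, hc1, hc2⟩ := hc.isCompact.exists_isLeast hne
      obtain ⟨d, hd1, hd2⟩ := hc.isCompact.exists_isGreatest hne
      exact ⟨c, d, Or.inl ⟨fun x hx => ⟨hc2 hx, hd2 hx⟩, (hs hc1).1, (hs hd1).2⟩⟩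
  · have hz : ∀ x, x ∉ Icc c d → ζ x = 0 := fun x hx => by
      by_contra hne
      exact hx (hcd (subset_tsupport ζ hne))
    have hsub : Function.support (fun x => ∫ t in a..x, ζ t) ⊆ Icc c d := by
      intro x hx
      by_contra hn
      apply hx
      rw [mem_Icc, not_and_or, not_le, not_le] at hn
      rcases hn with hn | hn
      · refine intervalIntegral.integral_zero_ae (ae_of_all _ fun t ht => hz t fun h => ?_)
        rcases le_total a x with h' | h'
        · rw [uIoc_of_le h'] at ht
          linarith [ht.2, h.1]
        · rw [uIoc_of_ge h'] at ht
          linarith [ht.2, h.1]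
      -- Right of `d`, the vanishing mean moves the base point from `a` to `b`.
      · change ∫ t in a..x, ζ t = 0
        rw [← intervalIntegral.integral_add_adjacent_intervals (hii a b) (hii b x), h0, zero_add]
        refine intervalIntegral.integral_zero_ae (ae_of_all _ fun t ht => hz t fun h => ?_)
        rcases le_total b x with h' | h'
        · rw [uIoc_of_le h'] at ht
          linarith [ht.1, h.2]
        · rw [uIoc_of_ge h'] at ht
          linarith [ht.1, h.2]
    have hts : tsupport (fun x => ∫ t in a..x, ζ t) ⊆ Icc c d :=
      closure_minimal hsub isClosed_Icc
    exact ⟨contDiff_infty_iff_deriv.2 ⟨fun x => (hd x).differentiableAt, by rwa [hderiv]⟩, hderiv,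
      isCompact_Icc.of_isClosed_subset (isClosed_tsupport _) hts,
      fun x hx => ⟨hac.trans_le (hts hx).1, (hts hx).2.trans_lt hdb⟩⟩
  · have e : (fun x => ∫ t in a..x, ζ t) = 0 := by
      ext x
      simp [h]
    refine ⟨e ▸ contDiff_const, hderiv, e ▸ HasCompactSupport.zero, ?_⟩
    rw [e]
    simp [tsupport]

/-- A smooth function with integral one and compact support in `(0,1)`. -/
theorem exists_testFunction_integral_one : ∃ η : ℝ → ℝ, ContDiff ℝ ∞ η ∧ HasCompactSupport η ∧
    tsupport η ⊆ Ioo 0 1 ∧ ∫ x in Ioo (0 : ℝ) 1, η x = 1 := by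
  let b : ContDiffBump (1 / 2 : ℝ) := ⟨1 / 8, 1 / 4, by norm_num, by norm_num⟩
  have hs : tsupport (b.normed volume) ⊆ Ioo 0 1 := by
    rw [b.tsupport_normed_eq, Real.closedBall_eq_Icc]
    intro x hx
    simp only [b, mem_Icc] at hx
    constructor <;> linarith [hx.1, hx.2]
  refine ⟨b.normed volume, b.contDiff_normed, b.hasCompactSupport_normed, hs, ?_⟩
  rw [setIntegral_eq_integral_of_forall_compl_eq_zero, b.integral_normed]
  intro x hx
  by_contra hne
  exact hx (hs (subset_tsupport _ hne))

theorem integrable_of_X (g : X) : Integrable g vol01 := (Lp.memLp g).integrable (by norm_num)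

theorem integrable_lt_prod (g : X) :
    Integrable (fun p : ℝ × ℝ => (Ioi p.1).indicator (g : ℝ → ℂ) p.2) (vol01.prod vol01) := by
  have h := (integrable_of_X g).comp_snd vol01
  have e : (fun p : ℝ × ℝ => (Ioi p.1).indicator (g : ℝ → ℂ) p.2)
      = {p : ℝ × ℝ | p.1 < p.2}.indicator (fun p => g p.2) := by
    ext p
    by_cases hp : p.1 < p.2
    · rw [indicator_of_mem (show p.2 ∈ Ioi p.1 from hp), indicator_of_mem (show p ∈ _ from hp)]
    · rw [indicator_of_notMem (show p.2 ∉ Ioi p.1 from hp),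
        indicator_of_notMem (show p ∉ {p : ℝ × ℝ | p.1 < p.2} from hp)]
  rw [e]
  exact h.indicator (measurableSet_lt measurable_fst measurable_snd)

/-- Integration by parts for a test function and the primitive of an `L²` function. -/
theorem integral_primitive_smul (g : X) {ψ : ℝ → ℝ} (hψ : Continuous ψ)
    (hc : HasCompactSupport ψ) :
    ∫ x in Ioo (0 : ℝ) 1, ψ x • ∫ t in Ioo (0 : ℝ) 1, (Ioi x).indicator (g : ℝ → ℂ) t
      = ∫ t in Ioo (0 : ℝ) 1, (∫ x in (0 : ℝ)..t, ψ x) • g t := by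
  obtain ⟨C, hC⟩ := hc.exists_bound_of_continuous hψ
  have hint : Integrable (fun p : ℝ × ℝ => ψ p.1 • (Ioi p.1).indicator (g : ℝ → ℂ) p.2)
      (vol01.prod vol01) :=
    (integrable_lt_prod g).bdd_smul C (hψ.comp continuous_fst).aestronglyMeasurable
      (Eventually.of_forall fun p => hC p.1)
  simp_rw [← integral_smul]
  -- Fubini on the triangle `x < t`.
  rw [integral_integral_swap hint]
  refine setIntegral_congr_fun measurableSet_Ioo fun t ht => ?_
  have e : ∀ x, ψ x • (Ioi x).indicator (g : ℝ → ℂ) t = (Iio t).indicator (fun x => ψ x • g t) x := by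
    intro x
    by_cases hx : x < t
    · rw [indicator_of_mem (show t ∈ Ioi x from hx), indicator_of_mem (show x ∈ Iio t from hx)]
    · rw [indicator_of_notMem (show t ∉ Ioi x from hx),
        indicator_of_notMem (show x ∉ Iio t from hx), smul_zero]
  simp only [e]
  rw [setIntegral_indicator measurableSet_Iio, integral_smul_const,
    intervalIntegral.integral_of_le ht.1.le, integral_Ioc_eq_integral_Ioo]
  congr 3
  ext x
  exact ⟨fun h => ⟨h.1.1, h.2⟩, fun h => ⟨⟨h.1, h.2.trans ht.2⟩, h.2⟩⟩

/-- The pairing with an essentially bounded function, as an `L²` functional. -/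
theorem exists_integral_smul_functional {w : ℝ → ℝ} (hw : Measurable w) {C : ℝ} (hC0 : 0 ≤ C)
    (hC : ∀ x, ‖w x‖ ≤ C) :
    ∃ L : X →L[ℂ] ℂ, ‖L‖ ≤ C ∧ ∀ g : X, L g = ∫ x in Ioo (0 : ℝ) 1, w x • g x := by
  have hm : MemLp (fun x => (w x : ℂ)) 2 vol01 :=
    MemLp.of_bound (by fun_prop) C (Eventually.of_forall fun x => by
      rw [Complex.norm_real]
      exact hC x)
  refine ⟨innerSL ℂ (hm.toLp _), ?_, fun g => ?_⟩
  · rw [innerSL_apply_norm]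
    refine (Lp.norm_le_of_ae_bound hC0 (C := C) ?_).trans ?_
    · filter_upwards [hm.coeFn_toLp] with x hx
      rw [hx, Complex.norm_real]
      exact hC x
    -- The interval has total mass one, so the sup bound also bounds the `L²` norm.
    · simp [measureUnivNNReal]
  · rw [innerSL_apply_apply, L2.inner_def]
    refine integral_congr_ae ?_
    filter_upwards [hm.coeFn_toLp] with x hx
    rw [hx]
    simp [mul_comm]

/-- Functions in `H¹(0,1)` are a.e. given by a bounded family of functionals. -/
theorem exists_evaluation : ∃ (L : ℝ → H1 →L[ℂ] ℂ) (C : ℝ), (∀ x, ‖L x‖ ≤ C) ∧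
    ∀ f : H1, ∀ᵐ x ∂vol01, toX f x = L x f := by
  obtain ⟨η, hη, hηc, hηs, hη1⟩ := exists_testFunction_integral_one
  let θ : ℝ → ℝ := fun t => ∫ x in (0 : ℝ)..t, η x
  obtain ⟨C, hC⟩ := hηc.exists_bound_of_continuous hη.continuous
  have hC0 : 0 ≤ C := (norm_nonneg _).trans (hC 0)
  have hθc : Continuous θ := intervalIntegral.continuous_primitive
    (fun u v => hη.continuous.intervalIntegrable u v) 0
  obtain ⟨P, hP, hPg⟩ := exists_integral_smul_functional hη.continuous.measurable hC0 hC
  -- Averaging `u(x) = u(1) - ∫ₓ¹ u'` against `η` eliminates `u(1)`: `u(x) = ∫ η u + ∫ θ u' - ∫ₓ¹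
  -- u'`. The functional `P` gives the first term, `w x` the other two. The cutoff to `[0,1]` makes
  -- the bound on `w x` global.
  let w : ℝ → ℝ → ℝ := fun x => (Icc 0 1).indicator fun t => θ t - (Ioi x).indicator 1 t
  have hwm : ∀ x, Measurable (w x) := fun x =>
    (hθc.measurable.sub (measurable_one.indicator measurableSet_Ioi)).indicator measurableSet_Icc
  have hwC : ∀ x t, ‖w x t‖ ≤ C + 1 := by
    intro x t
    by_cases ht : t ∈ Icc (0 : ℝ) 1
    · simp only [w, indicator_of_mem ht]
      refine (norm_sub_le (θ t) ((Ioi x).indicator 1 t)).trans (add_le_add ?_ ?_)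
      · refine (intervalIntegral.norm_integral_le_of_norm_le_const fun y _ => hC y).trans ?_
        rw [sub_zero, abs_of_nonneg ht.1]
        exact mul_le_of_le_one_right hC0 ht.2
      · refine (norm_indicator_le_norm_self (1 : ℝ → ℝ) t).trans ?_
        simp
    · simp only [w, indicator_of_notMem ht, norm_zero]
      positivity
  choose Q hQ hQg using fun x => exists_integral_smul_functional (hwm x)
    (add_nonneg hC0 zero_le_one) (hwC x)
  let π₁ : H1 →L[ℂ] X := (WithLp.fstL 2 ℂ X X).comp H1.subtypeL
  let π₂ : H1 →L[ℂ] X := (WithLp.sndL 2 ℂ X X).comp H1.subtypeL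
  refine ⟨fun x => P.comp π₁ + (Q x).comp π₂, C * ‖π₁‖ + (C + 1) * ‖π₂‖, fun x => ?_, fun f => ?_⟩
  · refine (norm_add_le (P.comp π₁) ((Q x).comp π₂)).trans (add_le_add ?_ ?_)
    · exact (P.opNorm_comp_le π₁).trans (mul_le_mul_of_nonneg_right hP (norm_nonneg π₁))
    · exact ((Q x).opNorm_comp_le π₂).trans (mul_le_mul_of_nonneg_right (hQ x) (norm_nonneg π₂))
  set u : X := f.1.fst with hu
  set g : X := f.1.snd with hg
  have hug : IsWeakDeriv u g := f.2
  have hθg : Integrable (fun t => θ t • g t) vol01 := by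
    refine (integrable_of_X g).bdd_smul C hθc.aestronglyMeasurable ?_
    filter_upwards [ae_restrict_mem measurableSet_Ioo] with t ht
    refine (intervalIntegral.norm_integral_le_of_norm_le_const fun y _ => hC y).trans ?_
    rw [sub_zero, abs_of_nonneg ht.1.le]
    exact mul_le_of_le_one_right hC0 ht.2.le
  let G : ℝ → ℂ := fun x => ∫ t in Ioo (0 : ℝ) 1, (Ioi x).indicator (g : ℝ → ℂ) t
  have hG : Integrable G vol01 := (integrable_lt_prod g).integral_prod_left
  let c : ℂ := (∫ x in Ioo (0 : ℝ) 1, η x • u x) + ∫ t in Ioo (0 : ℝ) 1, θ t • g t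
  have hval : ∀ x, (P.comp π₁ + (Q x).comp π₂) f = c - G x := by
    intro x
    have e : (Q x) g = (∫ t in Ioo (0 : ℝ) 1, θ t • g t) - G x := by
      rw [hQg, ← integral_sub hθg ((integrable_of_X g).indicator measurableSet_Ioi)]
      refine setIntegral_congr_fun measurableSet_Ioo fun t ht => ?_
      simp only [w, indicator_of_mem (Ioo_subset_Icc_self ht), sub_smul]
      by_cases hx : t ∈ Ioi x
      · simp [indicator_of_mem hx]
      · simp [indicator_of_notMem hx]
    change P u + Q x g = _
    rw [hPg, e]
    ring
  have hint : Integrable (fun x => u x - (c - G x)) vol01 :=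
    (integrable_of_X u).sub ((integrable_const c).sub hG)
  -- By the fundamental lemma it suffices to test the claimed formula against every `ψ`.
  have key := isOpen_Ioo.ae_eq_zero_of_integral_contDiff_smul_eq_zero (U := Ioo (0 : ℝ) 1)
    (μ := vol01) (f := fun x => u x - (c - G x))
    (hint.locallyIntegrable.locallyIntegrableOn _) ?_
  · filter_upwards [key, ae_restrict_mem measurableSet_Ioo] with x hx hmem
    rw [hval]
    exact sub_eq_zero.1 (hx hmem)
  intro ψ hψ hψc hψs
  set m : ℝ := ∫ x in Ioo (0 : ℝ) 1, ψ x with hm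
  have hψi : Integrable ψ vol01 := (hψ.continuous.integrable_of_hasCompactSupport hψc).restrict
  have hηi : Integrable η vol01 := (hη.continuous.integrable_of_hasCompactSupport hηc).restrict
  -- Subtracting `m * η` makes the mean zero, so the primitive is an admissible test function for
  -- the weak derivative.
  have hζc : HasCompactSupport (fun x => ψ x - m * η x) := hψc.sub (hηc.mul_left (f := fun _ => m))
  have hζs : tsupport (fun x => ψ x - m * η x) ⊆ Ioo 0 1 := by
    refine (tsupport_sub ψ (fun x => m * η x)).trans (union_subset hψs ?_)
    exact (tsupport_mul_subset_right (f := fun _ => m)).trans hηs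
  have hζ0 : ∫ x in (0 : ℝ)..1, (ψ x - m * η x) = 0 := by
    rw [intervalIntegral.integral_of_le zero_le_one, integral_Ioc_eq_integral_Ioo,
      integral_sub hψi (hηi.const_mul m), integral_const_mul, hη1, mul_one, sub_self]
  obtain ⟨hφ, hφd, hφc, hφs⟩ := primitive_testFunction
    (hψ.sub (contDiff_const.mul hη)) hζc hζs hζ0
  have hw := hug _ hφ hφc hφs
  rw [hφd] at hw
  have hφe : ∀ t, ∫ x in (0 : ℝ)..t, (ψ x - m * η x) = (∫ x in (0 : ℝ)..t, ψ x) - m * θ t := by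
    intro t
    rw [intervalIntegral.integral_sub (hψ.continuous.intervalIntegrable _ _)
      ((hη.continuous.intervalIntegrable _ _).const_mul m), intervalIntegral.integral_const_mul]
  have hψu := integrable_smul_L2 u ψ hψ.continuous hψc
  have hηu := integrable_smul_L2 u η hη.continuous hηc
  obtain ⟨D, hD⟩ := hψc.exists_bound_of_continuous hψ.continuous
  have hD0 : 0 ≤ D := (norm_nonneg _).trans (hD 0)
  have hΨg : Integrable (fun t => (∫ x in (0 : ℝ)..t, ψ x) • g t) vol01 := by
    refine (integrable_of_X g).bdd_smul D (intervalIntegral.continuous_primitive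
      (fun u v => hψ.continuous.intervalIntegrable u v) 0).aestronglyMeasurable ?_
    filter_upwards [ae_restrict_mem measurableSet_Ioo] with t ht
    refine (intervalIntegral.norm_integral_le_of_norm_le_const fun y _ => hD y).trans ?_
    rw [sub_zero, abs_of_nonneg ht.1.le]
    exact mul_le_of_le_one_right hD0 ht.2.le
  have hψG : Integrable (fun x => ψ x • G x) vol01 :=
    hG.bdd_smul D hψ.continuous.aestronglyMeasurable (Eventually.of_forall hD)
  have hψcst : Integrable (fun x => ψ x • c) vol01 := hψi.smul_const c
  have hηu' : Integrable (fun x => m • η x • u x) vol01 := hηu.smul m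
  have hθg' : Integrable (fun t => m • θ t • g t) vol01 := hθg.smul m
  have hψcG : Integrable (fun x => ψ x • c - ψ x • G x) vol01 := hψcst.sub hψG
  have e₁ : ∫ x in Ioo (0 : ℝ) 1, (ψ x - m * η x) • u x
      = (∫ x in Ioo (0 : ℝ) 1, ψ x • u x) - m • ∫ x in Ioo (0 : ℝ) 1, η x • u x := by
    simp_rw [sub_smul, mul_smul]
    rw [integral_sub hψu hηu', integral_smul]
  have e₂ : ∫ t in Ioo (0 : ℝ) 1, (∫ x in (0 : ℝ)..t, (ψ x - m * η x)) • g t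
      = (∫ t in Ioo (0 : ℝ) 1, (∫ x in (0 : ℝ)..t, ψ x) • g t)
        - m • ∫ t in Ioo (0 : ℝ) 1, θ t • g t := by
    simp_rw [hφe, sub_smul, mul_smul]
    rw [integral_sub hΨg hθg', integral_smul]
  rw [e₁, e₂, ← integral_primitive_smul g hψ.continuous hψc] at hw
  simp_rw [smul_sub]
  rw [integral_sub hψu hψcG, integral_sub hψcst hψG, integral_smul_const, ← hm]
  simp only [c, smul_add]
  linear_combination hw

/-! ## Weak convergence in `H¹(0,1)` and the forward operators -/

theorem WeakTendsto.tendsto_apply {u : ℕ → H1} {f : H1} (h : WeakTendsto u f)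
    (L : H1 →L[ℂ] ℂ) : Tendsto (fun n => L (u n)) atTop (𝓝 (L f)) :=
  ((WeakBilin.eval_continuous (topDualPairing ℂ H1).flip L).tendsto _).comp h

/-- Weakly bounded sequences in a normed space are bounded. -/
theorem exists_norm_le_of_weakly_bounded {E : Type*} [NormedAddCommGroup E] [NormedSpace ℂ E]
    {u : ℕ → E} (h : ∀ L : E →L[ℂ] ℂ, ∃ M, ∀ n, ‖L (u n)‖ ≤ M) : ∃ M, ∀ n, ‖u n‖ ≤ M := by
  -- Uniform boundedness is applied on the dual, which is complete; the embedding into the double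
  -- dual is isometric.
  obtain ⟨M, hM⟩ := banach_steinhaus
    (g := fun n => NormedSpace.inclusionInDoubleDual ℂ E (u n)) h
  exact ⟨M, fun n => ((NormedSpace.inclusionInDoubleDualLi (E := E) ℂ).norm_map (u n)).symm.trans_le
    (hM n)⟩

theorem WeakTendsto.exists_norm_le {u : ℕ → H1} {f : H1} (h : WeakTendsto u f) :
    ∃ M, ∀ n, ‖u n‖ ≤ M :=
  exists_norm_le_of_weakly_bounded fun L => by
    obtain ⟨M, hM⟩ := (h.tendsto_apply L).norm.bddAbove_range
    exact ⟨M, fun n => hM (mem_range_self n)⟩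

/-- Weakly convergent sequences in `H¹(0,1)` are essentially bounded and converge a.e. -/
theorem WeakTendsto.exists_bound_and_ae_tendsto {u : ℕ → H1} {f : H1} (h : WeakTendsto u f) :
    ∃ M : ℝ, 0 ≤ M ∧ ∀ᵐ x ∂vol01, (∀ n, ‖toX (u n) x‖ ≤ M) ∧
      Tendsto (fun n => toX (u n) x) atTop (𝓝 (toX f x)) := by
  obtain ⟨L, C, hC, hL⟩ := exists_evaluation
  obtain ⟨M, hM⟩ := h.exists_norm_le
  have hC0 : 0 ≤ C := (norm_nonneg (L 0)).trans (hC 0)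
  have hM0 : 0 ≤ M := (norm_nonneg _).trans (hM 0)
  refine ⟨C * M, by positivity, ?_⟩
  filter_upwards [hL f, ae_all_iff.2 fun n => hL (u n)] with x hx hxn
  refine ⟨fun n => ?_, ?_⟩
  · rw [hxn]
    exact (L x).le_of_opNorm_le_of_le (hC x) (hM n)
  · simp_rw [hx, hxn]
    exact h.tendsto_apply (L x)

/-- Bounded convergence in `L²` over a finite measure space. -/
theorem tendsto_L2_of_bounded {α E : Type*} [MeasurableSpace α] {μ : Measure α}
    [IsFiniteMeasure μ] [NormedAddCommGroup E] {F : ℕ → Lp E 2 μ} {G : Lp E 2 μ} (M : ℝ)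
    (hM : ∀ n, ∀ᵐ x ∂μ, ‖F n x‖ ≤ M)
    (h : ∀ᵐ x ∂μ, Tendsto (fun n => F n x) atTop (𝓝 (G x))) : Tendsto F atTop (𝓝 G) := by
  rw [Lp.tendsto_Lp_iff_tendsto_eLpNorm']
  refine tendsto_Lp_finite_of_tendsto_ae (by norm_num) (by norm_num)
    (fun n => (Lp.memLp (F n)).1) (Lp.memLp G) ?_ h
  refine unifIntegrable_of (by norm_num) (by norm_num) (fun n => (Lp.memLp (F n)).1) fun e _ => ?_
  -- A threshold strictly above the bound makes the tail vanish a.e.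
  refine ⟨M.toNNReal + 1, fun n => ?_⟩
  rw [eLpNorm_congr_ae (g := fun _ => 0) ?_]
  · simp
  · filter_upwards [hM n] with x hx
    refine indicator_of_notMem (fun hmem => ?_) _
    have h1 : M.toNNReal + 1 ≤ ‖F n x‖₊ := hmem
    have h2 : ‖F n x‖₊ ≤ M.toNNReal := by
      rw [← norm_toNNReal]
      exact Real.toNNReal_le_toNNReal hx
    exact absurd (h1.trans h2) (by simp)

/-- Bounded a.e. convergence of the factors implies convergence of the autoconvolutions. -/
theorem tendsto_autoconvFun {k : ℝ → ℝ → ℂ} (hk : IsKernel k) {u : ℕ → X} {f : X} {M : ℝ}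
    (hM0 : 0 ≤ M) (h : ∀ᵐ x ∂vol01, (∀ n, ‖u n x‖ ≤ M) ∧
      Tendsto (fun n => u n x) atTop (𝓝 (f x))) {s : ℝ} (hs : s ∈ Ioo (0 : ℝ) 2) :
    Tendsto (fun n => autoconvFun k (u n) s) atTop (𝓝 (autoconvFun k f s)) := by
  obtain ⟨C, hC0, hC⟩ := hk.exists_bound
  have hle : max (s - 1) 0 ≤ min s 1 :=
    max_le (le_min (by linarith) (by linarith [hs.2])) (le_min hs.1.le zero_le_one)
  have h' : ∀ᵐ x : ℝ, x ∈ Ioo (0 : ℝ) 1 → (∀ n, ‖u n x‖ ≤ M) ∧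
      Tendsto (fun n => u n x) atTop (𝓝 (f x)) := (ae_restrict_iff' measurableSet_Ioo).1 h
  -- The reflection `τ ↦ s - τ` preserves null sets, so the reflected factor converges a.e. too.
  have h'' := (Measure.measurePreserving_sub_left volume s).quasiMeasurePreserving.ae h'
  have key : ∀ᵐ τ : ℝ, τ ∈ uIoc (max (s - 1) 0) (min s 1) →
      ((∀ n, ‖u n τ‖ ≤ M) ∧ Tendsto (fun n => u n τ) atTop (𝓝 (f τ))) ∧
      ((∀ n, ‖u n (s - τ)‖ ≤ M) ∧ Tendsto (fun n => u n (s - τ)) atTop (𝓝 (f (s - τ)))) := by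
    -- The points `τ = s` and `τ = 1` are discarded so that `τ` and `s - τ` lie in the open
    -- interval.
    filter_upwards [h', h'', (countable_singleton s).ae_notMem volume,
      (countable_singleton (1 : ℝ)).ae_notMem volume] with τ h₁ h₂ h₃ h₄ hτ
    rw [uIoc_of_le hle, mem_Ioc, max_lt_iff, le_min_iff] at hτ
    have h₅ : τ < s := lt_of_le_of_ne hτ.2.1 h₃
    have h₆ : τ < 1 := lt_of_le_of_ne hτ.2.2 h₄
    exact ⟨h₁ ⟨hτ.1.2, h₆⟩, h₂ ⟨by linarith, by linarith [hτ.1.1]⟩⟩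
  have hm : ∀ g : X, Measurable (g : ℝ → ℂ) := fun g => (Lp.stronglyMeasurable g).measurable
  refine intervalIntegral.tendsto_integral_filter_of_dominated_convergence
    (fun _ => C * M * M) (Eventually.of_forall fun n => ?_) (Eventually.of_forall fun n => ?_)
    intervalIntegrable_const ?_
  · exact (((hk.measurable.comp (measurable_const.prodMk measurable_id)).mul
      ((hm (u n)).comp (measurable_const.sub measurable_id))).mul (hm (u n))).aestronglyMeasurable
  · filter_upwards [key] with τ hτ hmem
    rw [norm_mul, norm_mul]
    have := (hτ hmem).1.1 n
    have := (hτ hmem).2.1 n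
    have := hC s τ
    gcongr
  · filter_upwards [key] with τ hτ hmem
    exact ((hτ hmem).2.2.const_mul _).mul (hτ hmem).1.2

theorem continuous_signFun {ε : ℝ} (hε : 0 < ε) : Continuous (signFun ε) := by
  unfold signFun
  refine continuous_id.div (by fun_prop) fun z => ?_
  exact_mod_cast (hε.trans_le (le_max_left ε ‖z‖)).ne'

theorem norm_signFun_le (ε : ℝ) (z : ℂ) : ‖signFun ε z‖ ≤ 1 := by
  have h0 : 0 ≤ max ε ‖z‖ := (norm_nonneg _).trans (le_max_right _ _)
  rw [signFun, norm_div, Complex.norm_real, Real.norm_of_nonneg h0]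
  exact div_le_one_of_le₀ (le_max_right _ _) h0

/-- The autoconvolutions converge at every `s` in `(0,2)`, and `Sign_ε` supplies the dominating
constant 1. -/
theorem WeakTendsto.tendsto_signOp_autoconv {k : ℝ → ℝ → ℂ} (hk : IsKernel k) {ε : ℝ}
    (hε : 0 < ε) {u : ℕ → H1} {f : H1} (h : WeakTendsto u f) :
    Tendsto (fun n => signOp ε (autoconv k hk (toX (u n)))) atTop
      (𝓝 (signOp ε (autoconv k hk (toX f)))) := by
  obtain ⟨M, hM0, hM⟩ := h.exists_bound_and_ae_tendsto
  have hco : ∀ g : X, signOp ε (autoconv k hk g) =ᵐ[vol02] fun s => signFun ε (autoconvFun k g s) := by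
    intro g
    filter_upwards [(memLp_signFun ε (autoconv k hk g)).coeFn_toLp,
      (memLp_autoconvFun hk g).coeFn_toLp] with s h₁ h₂
    rw [signOp, h₁, autoconv, h₂]
  refine tendsto_L2_of_bounded 1 (fun n => ?_) ?_
  · filter_upwards [hco (toX (u n))] with s hs
    rw [hs]
    exact norm_signFun_le ε _
  · filter_upwards [hco (toX f), ae_all_iff.2 fun n => hco (toX (u n)),
      ae_restrict_mem measurableSet_Ioo] with s h₁ h₂ hs
    simp_rw [h₁, h₂]
    exact ((continuous_signFun hε).tendsto _).comp (tendsto_autoconvFun hk hM0 hM hs)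

theorem WeakTendsto.tendsto_modulus {u : ℕ → H1} {f : H1} (h : WeakTendsto u f) :
    Tendsto (fun n => modulus (toX (u n))) atTop (𝓝 (modulus (toX f))) := by
  obtain ⟨M, hM0, hM⟩ := h.exists_bound_and_ae_tendsto
  have hco : ∀ g : X, modulus g =ᵐ[vol01] fun s => ‖g s‖ := fun g => (Lp.memLp g).norm.coeFn_toLp
  refine tendsto_L2_of_bounded M (fun n => ?_) ?_
  · filter_upwards [hco (toX (u n)), hM] with s hs hs'
    rw [hs, norm_norm]
    exact hs'.1 n
  · filter_upwards [hco (toX f), ae_all_iff.2 fun n => hco (toX (u n)), hM] with s h₁ h₂ hs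
    simp_rw [h₁, h₂]
    exact hs.2.norm

/-! ## The direct method and the Tikhonov functional -/

/-- The direct method: a functional with weakly sequentially precompact sublevel sets attains its
minimum on a nonempty weakly sequentially closed set on which it is lower semicontinuous. -/
theorem exists_isMinOn {T : H1 → EReal} {S : Set H1} (hS : S.Nonempty)
    (hlsc : ∀ (u : ℕ → H1) (f : H1), (∀ n, u n ∈ S) → WeakTendsto u f →
      f ∈ S ∧ T f ≤ liminf (fun n => T (u n)) atTop)
    (hpre : ∀ (M : ℝ) (u : ℕ → H1), (∀ n, T (u n) ≤ (M : EReal)) →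
      ∃ (φ : ℕ → ℕ) (f : H1), StrictMono φ ∧ WeakTendsto (u ∘ φ) f) :
    ∃ f ∈ S, ∀ g ∈ S, T f ≤ T g := by
  -- Only an infimum below `⊤` leaves room for a real level `M` above it; otherwise every point of
  -- `S` is a minimizer.
  by_cases htop : sInf (T '' S) = ⊤
  · obtain ⟨f, hf⟩ := hS
    refine ⟨f, hf, fun g hg => ?_⟩
    rw [sInf_eq_top.1 htop _ (mem_image_of_mem T hg)]
    exact le_top
  obtain ⟨v, -, hv, hvS⟩ := exists_seq_tendsto_sInf (hS.image T) (OrderBot.bddBelow _)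
  choose u huS huv using hvS
  obtain ⟨M, hM, -⟩ := EReal.lt_iff_exists_real_btwn.1 (lt_top_iff_ne_top.2 htop)
  obtain ⟨N, hN⟩ := eventually_atTop.1 (hv.eventually (gt_mem_nhds hM))
  obtain ⟨φ, f, hφ, hf⟩ := hpre M (fun n => u (n + N)) fun n => by
    rw [huv]
    exact (hN _ (Nat.le_add_left N n)).le
  obtain ⟨hfS, hle⟩ := hlsc _ f (fun n => huS _) hf
  refine ⟨f, hfS, fun g hg => hle.trans ?_⟩
  have hlim : Tendsto (fun n => T (u (φ n + N))) atTop (𝓝 (sInf (T '' S))) := by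
    simp only [huv]
    exact hv.comp ((tendsto_add_atTop_nat N).comp hφ.tendsto_atTop)
  rw [hlim.liminf_eq]
  exact sInf_le (mem_image_of_mem T hg)

/-- The direct method applied to `R` itself: the minimum is attained, and it is real because `R` is
proper. -/
theorem IsStabilizing.exists_lower_bound {R : H1 → EReal} (hR : IsStabilizing R) :
    ∃ m : ℝ, ∀ g, (m : EReal) ≤ R g := by
  obtain ⟨f, -, hf⟩ := exists_isMinOn (T := R) univ_nonempty
    (fun u f _ h => ⟨mem_univ _, hR.lsc u f h⟩) hR.precompact
  obtain ⟨g, hg⟩ := hR.exists_ne_top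
  refine ⟨(R f).toReal, fun h => ?_⟩
  rw [EReal.coe_toReal (ne_top_of_le_ne_top hg (hf g (mem_univ _))) (hR.ne_bot f)]
  exact hf h (mem_univ _)

/-- Addition on `EReal` is continuous here because one summand stays finite. -/
theorem tendsto_add_coe {e : ℕ → ℝ} {l : ℝ} (he : Tendsto e atTop (𝓝 l)) (x : EReal) :
    Tendsto (fun n => x + (e n : EReal)) atTop (𝓝 (x + l)) :=
  (EReal.continuousAt_add (p := (x, (l : EReal))) (Or.inr (EReal.coe_ne_bot l))
    (Or.inr (EReal.coe_ne_top l))).tendsto.comp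
    (tendsto_const_nhds.prodMk_nhds (EReal.tendsto_coe.2 he))

/-- Passage to the limit in `R (u n) ≤ R g + e n`. -/
theorem IsStabilizing.le_of_weakTendsto {R : H1 → EReal} (hR : IsStabilizing R) {u : ℕ → H1}
    {f g : H1} (h : WeakTendsto u f) {e : ℕ → ℝ} {l : ℝ} (he : Tendsto e atTop (𝓝 l))
    (hle : ∀ n, R (u n) ≤ R g + (e n : EReal)) : R f ≤ R g + (l : EReal) := by
  have hw := tendsto_add_coe he (R g)
  refine (hR.lsc u f h).trans ?_
  rw [← hw.liminf_eq]
  exact liminf_le_liminf (Eventually.of_forall hle)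

/-- Lower semicontinuity bounds the liminf from below, comparison with the limit bounds the limsup
from above. -/
theorem IsStabilizing.tendsto_of_weakTendsto {R : H1 → EReal} (hR : IsStabilizing R) {u : ℕ → H1}
    {f : H1} (h : WeakTendsto u f) {e : ℕ → ℝ} (he : Tendsto e atTop (𝓝 0))
    (hle : ∀ n, R (u n) ≤ R f + (e n : EReal)) : Tendsto (fun n => R (u n)) atTop (𝓝 (R f)) := by
  have hw := tendsto_add_coe he (R f)
  rw [EReal.coe_zero, add_zero] at hw
  refine tendsto_of_le_liminf_of_limsup_le (hR.lsc u f h) ?_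
  rw [← hw.limsup_eq]
  exact limsup_le_limsup (Eventually.of_forall hle)

theorem IsStabilizing.exists_subseq {R : H1 → EReal} (hR : IsStabilizing R) {u : ℕ → H1}
    {g : H1} (hg : R g ≠ ⊤) {e : ℕ → ℝ} {l : ℝ} (he : Tendsto e atTop (𝓝 l))
    (hle : ∀ n, R (u n) ≤ R g + (e n : EReal)) :
    ∃ (φ : ℕ → ℕ) (f : H1), StrictMono φ ∧ WeakTendsto (u ∘ φ) f := by
  obtain ⟨B, hB⟩ := he.bddAbove_range
  refine hR.precompact ((R g).toReal + B) u fun n => (hle n).trans ?_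
  rw [EReal.coe_add, EReal.coe_toReal hg (hR.ne_bot g)]
  exact add_le_add_right (EReal.coe_le_coe (hB ⟨n, rfl⟩)) _

/-! ### The misfit, and minimality as a bound on the penalty -/

/-- The data fidelity part of the Tikhonov functional. -/
def misfit (k : ℝ → ℝ → ℂ) (hk : IsKernel k) (ε β : ℝ) (y : Y) (a : RealL201) (f : H1) : ℝ :=
  1 / 2 * ‖signOp ε (autoconv k hk (toX f)) - y‖ ^ 2 + β / 2 * ‖modulus (toX f) - a‖ ^ 2

section Misfit

variable {k : ℝ → ℝ → ℂ} {hk : IsKernel k} {ε β : ℝ}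

theorem misfit_nonneg (hβ : 0 < β) (y : Y) (a : RealL201) (f : H1) :
    0 ≤ misfit k hk ε β y a f := by
  unfold misfit
  positivity

theorem isSolution_of_misfit_nonpos (hβ : 0 < β) {y : Y} {a : RealL201} {f : H1}
    (h : misfit k hk ε β y a f ≤ 0) : IsSolution k hk ε y a f := by
  unfold misfit at h
  have h₁ : 0 ≤ ‖signOp ε (autoconv k hk (toX f)) - y‖ ^ 2 := by positivity
  have h₂ : 0 ≤ β / 2 * ‖modulus (toX f) - a‖ ^ 2 := by positivity
  have e₁ : ‖signOp ε (autoconv k hk (toX f)) - y‖ ^ 2 = 0 := by linarith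
  have e₂ : β / 2 * ‖modulus (toX f) - a‖ ^ 2 = 0 := by linarith
  constructor
  · exact sub_eq_zero.1 (norm_eq_zero.1 (pow_eq_zero_iff two_ne_zero |>.1 e₁))
  · exact sub_eq_zero.1 (norm_eq_zero.1 (pow_eq_zero_iff two_ne_zero |>.1
      ((mul_eq_zero.1 e₂).resolve_left (by positivity))))

/-- At an exact solution only the data noise remains. The common constant is crude, chosen so that
`δ² + σ²` appears as in the parameter choice. -/
theorem IsSolution.misfit_le (hβ : 0 < β) {y y' : Y} {a a' : RealL201} {g : H1}
    (hg : IsSolution k hk ε y a g) {δ σ : ℝ} (hy : ‖y' - y‖ ≤ δ) (ha : ‖a' - a‖ ≤ σ) :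
    misfit k hk ε β y' a' g ≤ (1 / 2 + β / 2) * (δ ^ 2 + σ ^ 2) := by
  rw [misfit, hg.1, hg.2, norm_sub_rev y, norm_sub_rev a]
  have h₁ : ‖y' - y‖ ^ 2 ≤ δ ^ 2 := pow_le_pow_left₀ (norm_nonneg _) hy 2
  have h₂ : ‖a' - a‖ ^ 2 ≤ σ ^ 2 := pow_le_pow_left₀ (norm_nonneg _) ha 2
  have h₃ : β / 2 * ‖a' - a‖ ^ 2 ≤ β / 2 * σ ^ 2 := by gcongr
  have h₄ : 0 ≤ β / 2 * δ ^ 2 := by positivity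
  linarith [sq_nonneg σ]

theorem tendsto_misfit (hε : 0 < ε) {ys : ℕ → Y} {y : Y} {as : ℕ → RealL201} {a : RealL201}
    {u : ℕ → H1} {f : H1} (hy : Tendsto (fun n => ‖ys n - y‖) atTop (𝓝 0))
    (ha : Tendsto (fun n => ‖as n - a‖) atTop (𝓝 0)) (h : WeakTendsto u f) :
    Tendsto (fun n => misfit k hk ε β (ys n) (as n) (u n)) atTop (𝓝 (misfit k hk ε β y a f)) :=
  ((((h.tendsto_signOp_autoconv hk hε).sub
    (tendsto_iff_norm_sub_tendsto_zero.2 hy)).norm.pow 2).const_mul _).add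
    (((h.tendsto_modulus.sub (tendsto_iff_norm_sub_tendsto_zero.2 ha)).norm.pow 2).const_mul _)

theorem weakTendsto_const (f : H1) : WeakTendsto (fun _ => f) f := tendsto_const_nhds

theorem IsSolution.of_weakTendsto (hε : 0 < ε) {y : Y} {a : RealL201} {u : ℕ → H1} {f : H1}
    (hu : ∀ n, IsSolution k hk ε y a (u n)) (h : WeakTendsto u f) : IsSolution k hk ε y a f := by
  have h₁ := h.tendsto_signOp_autoconv hk hε
  have h₂ := h.tendsto_modulus
  simp_rw [fun n => (hu n).1] at h₁
  simp_rw [fun n => (hu n).2] at h₂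
  exact ⟨tendsto_nhds_unique h₁ tendsto_const_nhds, tendsto_nhds_unique h₂ tendsto_const_nhds⟩

/-- This confines the infinite cases to one place: afterwards penalties are compared up to a real
error. -/
theorem coe_add_mul_le_iff {b c α : ℝ} (hα : 0 < α) {x z : EReal} (hx : x ≠ ⊥) (hz : z ≠ ⊥) :
    (b : EReal) + α * x ≤ c + α * z ↔ x ≤ z + ((c - b) / α : ℝ) := by
  induction z with
  | bot => exact absurd rfl hz
  | top => simp [EReal.coe_mul_top_of_pos hα]
  | coe z =>
    induction x with
    | bot => exact absurd rfl hx
    | top =>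
      rw [EReal.coe_mul_top_of_pos hα, EReal.coe_add_top, ← EReal.coe_mul, ← EReal.coe_add,
        ← EReal.coe_add, top_le_iff, top_le_iff]
      simp only [EReal.coe_ne_top]
    | coe x =>
      norm_cast
      rw [← sub_le_iff_le_add' (a := x), le_div_iff₀ hα]
      constructor <;> intro h <;> linarith

/-- Minimality in the Tikhonov functional as a family of bounds on the penalty. -/
theorem isMinimizer_tikhonov_iff {R : H1 → EReal} (hR : IsStabilizing R) {α : ℝ} (hα : 0 < α)
    {y : Y} {a : RealL201} {f : H1} :
    IsMinimizer (tikhonov k hk R ε β α y a) f ↔ ∀ g,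
      R f ≤ R g + ((misfit k hk ε β y a g - misfit k hk ε β y a f) / α : ℝ) := by
  rw [IsMinimizer, isMinOn_univ_iff]
  exact forall_congr' fun g => coe_add_mul_le_iff hα (hR.ne_bot f) (hR.ne_bot g)

/-- The nonnegative misfit of `f` is dropped, leaving a bound that depends only on the competitor
and the data. -/
theorem le_add_of_isMinimizer {R : H1 → EReal} (hR : IsStabilizing R) (hβ : 0 < β) {α : ℝ}
    (hα : 0 < α) {y : Y} {a : RealL201} {f : H1}
    (hf : IsMinimizer (tikhonov k hk R ε β α y a) f) (g : H1) :
    R f ≤ R g + (misfit k hk ε β y a g / α : ℝ) := by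
  refine ((isMinimizer_tikhonov_iff hR hα).1 hf g).trans (add_le_add_right ?_ _)
  refine EReal.coe_le_coe ?_
  have := misfit_nonneg (k := k) (hk := hk) (ε := ε) hβ y a f
  gcongr
  linarith

/-! ### Existence and stability -/

/-- Existence of minimizers. -/
theorem exists_isMinimizer_tikhonov {R : H1 → EReal} (hR : IsStabilizing R) (hε : 0 < ε)
    (hβ : 0 < β) {α : ℝ} (hα : 0 < α) (y : Y) (a : RealL201) :
    ∃ f, IsMinimizer (tikhonov k hk R ε β α y a) f := by
  -- After division by `α`, each sublevel set lies in the sublevel set of `R` at the same `M`.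
  have hmin : ∃ f ∈ univ, ∀ g ∈ univ, R f + ((misfit k hk ε β y a f / α : ℝ) : EReal)
      ≤ R g + ((misfit k hk ε β y a g / α : ℝ) : EReal) := by
    refine exists_isMinOn univ_nonempty ?_ ?_
    · intro u f _ h
      have hm := (tendsto_misfit (k := k) (hk := hk) (β := β) (y := y) (a := a) (ys := fun _ => y)
        (as := fun _ => a) hε (by simp) (by simp) h).div_const α
      refine ⟨mem_univ f, le_trans ?_ (EReal.le_liminf_add (f := atTop) (u := fun n => R (u n))
        (v := fun n => ((misfit k hk ε β y a (u n) / α : ℝ) : EReal)))⟩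
      rw [(EReal.tendsto_coe.2 hm).liminf_eq]
      exact add_le_add_left (hR.lsc u f h) _
    · intro M u hu
      refine hR.precompact M u fun n => le_trans ?_ (hu n)
      refine le_add_of_nonneg_right (EReal.coe_nonneg.2 ?_)
      have := misfit_nonneg (k := k) (hk := hk) (ε := ε) hβ y a (u n)
      positivity
  obtain ⟨f, -, hf⟩ := hmin
  refine ⟨f, (isMinimizer_tikhonov_iff hR hα).2 fun g => ?_⟩
  have h := hf g (mem_univ g)
  have := (coe_add_mul_le_iff (b := misfit k hk ε β y a f / α)
    (c := misfit k hk ε β y a g / α) zero_lt_one (hR.ne_bot f) (hR.ne_bot g)).1 (by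
      rwa [EReal.coe_one, one_mul, one_mul, add_comm, add_comm _ (R g)])
  rwa [div_one, ← sub_div] at this

/-- Stability of minimizers under perturbations of the data. -/
theorem stability_tikhonov {R : H1 → EReal} (hR : IsStabilizing R) (hε : 0 < ε) (hβ : 0 < β)
    {α : ℝ} (hα : 0 < α) {y : Y} {a : RealL201} {ys : ℕ → Y} {as : ℕ → RealL201} {fs : ℕ → H1}
    (hy : Tendsto (fun n => ‖ys n - y‖) atTop (𝓝 0))
    (ha : Tendsto (fun n => ‖as n - a‖) atTop (𝓝 0))
    (hfs : ∀ n, IsMinimizer (tikhonov k hk R ε β α (ys n) (as n)) (fs n)) :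
    (∃ (φ : ℕ → ℕ) (f : H1), StrictMono φ ∧ WeakTendsto (fs ∘ φ) f) ∧
      ∀ (φ : ℕ → ℕ) (f : H1), StrictMono φ → WeakTendsto (fs ∘ φ) f →
        IsMinimizer (tikhonov k hk R ε β α y a) f ∧
        Tendsto (fun n => R (fs (φ n))) atTop (𝓝 (R f)) := by
  constructor
  · obtain ⟨g, hg⟩ := hR.exists_ne_top
    exact hR.exists_subseq hg
      ((tendsto_misfit (k := k) (hk := hk) (β := β) hε hy ha (weakTendsto_const g)).div_const α)
      fun n => le_add_of_isMinimizer hR hβ hα (hfs n) g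
  · intro φ f hφ h
    have hy' := hy.comp hφ.tendsto_atTop
    have ha' := ha.comp hφ.tendsto_atTop
    have hlim := fun g => ((tendsto_misfit (k := k) (hk := hk) (β := β) (ys := ys ∘ φ)
      (as := as ∘ φ) hε hy' ha' (weakTendsto_const g)).sub (tendsto_misfit (k := k) (hk := hk)
        (β := β) (ys := ys ∘ φ) (as := as ∘ φ) hε hy' ha' h)).div_const α
    have hle := fun n => (isMinimizer_tikhonov_iff hR hα).1 (hfs (φ n))
    refine ⟨(isMinimizer_tikhonov_iff hR hα).2 fun g =>
      hR.le_of_weakTendsto h (hlim g) fun n => hle n g, ?_⟩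
    -- With the weak limit as competitor the error terms tend to zero.
    have h0 := hlim f
    rw [sub_self, zero_div] at h0
    exact hR.tendsto_of_weakTendsto h h0 fun n => hle n f

/-! ### Penalty-minimizing solutions and vanishing noise -/

theorem exists_isRMinimizingSolution {R : H1 → EReal} (hR : IsStabilizing R) (hε : 0 < ε) {y : Y}
    {a : RealL201} (hsol : ∃ f, IsSolution k hk ε y a f ∧ R f ≠ ⊤) :
    ∃ f, IsRMinimizingSolution k hk R ε y a f := by
  obtain ⟨g, hg, hgR⟩ := hsol
  obtain ⟨f, hf, hmin⟩ := exists_isMinOn (T := R) (S := {f | IsSolution k hk ε y a f}) ⟨g, hg⟩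
    (fun u f hu h => ⟨IsSolution.of_weakTendsto hε hu h, hR.lsc u f h⟩) hR.precompact
  exact ⟨f, hf, ne_top_of_le_ne_top hgR (hmin g hg), hmin⟩

section Convergence

variable {R : H1 → EReal} {y : Y} {a : RealL201} {δ σ α : ℕ → ℝ} {ys : ℕ → Y}
  {as : ℕ → RealL201} {fs : ℕ → H1}

theorem le_add_of_isMinimizer_of_isSolution (hR : IsStabilizing R) (hβ : 0 < β)
    (hα : ∀ n, 0 < α n) (hy : ∀ n, ‖ys n - y‖ ≤ δ n) (ha : ∀ n, ‖as n - a‖ ≤ σ n)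
    (hfs : ∀ n, IsMinimizer (tikhonov k hk R ε β (α n) (ys n) (as n)) (fs n)) {g : H1}
    (hg : IsSolution k hk ε y a g) (n : ℕ) :
    R (fs n) ≤ R g + (((1 / 2 + β / 2) * ((δ n ^ 2 + σ n ^ 2) / α n) : ℝ) : EReal) := by
  refine (le_add_of_isMinimizer hR hβ (hα n) (hfs n) g).trans (add_le_add_right ?_ _)
  refine EReal.coe_le_coe ?_
  rw [← mul_div_assoc]
  have := hg.misfit_le (β := β) hβ (hy n) (ha n)
  have := (hα n).le
  gcongr

theorem exists_subseq_of_isMinimizer (hR : IsStabilizing R) (hβ : 0 < β)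
    (hα : ∀ n, 0 < α n) (hδσα : Tendsto (fun n => (δ n ^ 2 + σ n ^ 2) / α n) atTop (𝓝 0))
    (hy : ∀ n, ‖ys n - y‖ ≤ δ n) (ha : ∀ n, ‖as n - a‖ ≤ σ n)
    (hfs : ∀ n, IsMinimizer (tikhonov k hk R ε β (α n) (ys n) (as n)) (fs n))
    (hsol : ∃ f, IsSolution k hk ε y a f ∧ R f ≠ ⊤) :
    ∃ (φ : ℕ → ℕ) (f : H1), StrictMono φ ∧ WeakTendsto (fs ∘ φ) f := by
  obtain ⟨g, hg, hgR⟩ := hsol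
  exact hR.exists_subseq hgR (hδσα.const_mul _)
    (le_add_of_isMinimizer_of_isSolution hR hβ hα hy ha hfs hg)

/-- Weak limits of minimizers for vanishing noise are penalty-minimizing solutions. -/
theorem isRMinimizingSolution_of_weakTendsto (hR : IsStabilizing R) (hε : 0 < ε) (hβ : 0 < β)
    (hα : ∀ n, 0 < α n) (hδ : Tendsto δ atTop (𝓝 0)) (hσ : Tendsto σ atTop (𝓝 0))
    (hα0 : Tendsto α atTop (𝓝 0))
    (hδσα : Tendsto (fun n => (δ n ^ 2 + σ n ^ 2) / α n) atTop (𝓝 0))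
    (hy : ∀ n, ‖ys n - y‖ ≤ δ n) (ha : ∀ n, ‖as n - a‖ ≤ σ n)
    (hfs : ∀ n, IsMinimizer (tikhonov k hk R ε β (α n) (ys n) (as n)) (fs n))
    (hsol : ∃ f, IsSolution k hk ε y a f ∧ R f ≠ ⊤) {f : H1} (h : WeakTendsto fs f) :
    IsRMinimizingSolution k hk R ε y a f ∧ Tendsto (fun n => R (fs n)) atTop (𝓝 (R f)) := by
  have hle := fun (g : H1) (hg : IsSolution k hk ε y a g) =>
    le_add_of_isMinimizer_of_isSolution hR hβ hα hy ha hfs hg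
  have he : Tendsto (fun n => (1 / 2 + β / 2) * ((δ n ^ 2 + σ n ^ 2) / α n)) atTop (𝓝 0) := by
    simpa using hδσα.const_mul (1 / 2 + β / 2)
  have hyn := squeeze_zero (fun n => norm_nonneg _) hy hδ
  have han := squeeze_zero (fun n => norm_nonneg _) ha hσ
  have hmin : ∀ g, IsSolution k hk ε y a g → R f ≤ R g := fun g hg => by
    simpa using hR.le_of_weakTendsto h he (hle g hg)
  obtain ⟨g, hg, hgR⟩ := hsol
  have hf : IsSolution k hk ε y a f := by
    refine isSolution_of_misfit_nonpos hβ ?_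
    obtain ⟨m, hm⟩ := hR.exists_lower_bound
    -- With `m ≤ R`, minimality against `g` bounds the misfit of `fs n` by the misfit of `g` plus `α
    -- n * (R g - m)`; both vanish in the limit.
    have hlim : Tendsto (fun n => (1 / 2 + β / 2) * (δ n ^ 2 + σ n ^ 2)
        + α n * ((R g).toReal - m)) atTop (𝓝 0) := by
      simpa using (((hδ.pow 2).add (hσ.pow 2)).const_mul (1 / 2 + β / 2)).add
        (hα0.mul_const ((R g).toReal - m))
    refine le_of_tendsto_of_tendsto' (tendsto_misfit hε hyn han h) hlim fun n => ?_
    have h₁ := (hm (fs n)).trans ((isMinimizer_tikhonov_iff hR (hα n)).1 (hfs n) g)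
    rw [← EReal.coe_toReal hgR (hR.ne_bot g), ← EReal.coe_add, EReal.coe_le_coe_iff,
      ← sub_le_iff_le_add', le_div_iff₀ (hα n)] at h₁
    have h₂ := hg.misfit_le (β := β) hβ (hy n) (ha n)
    linarith
  exact ⟨⟨hf, ne_top_of_le_ne_top hgR (hmin g hg), hmin⟩,
    hR.tendsto_of_weakTendsto h he (hle f hf)⟩

end Convergence

end Misfit

end PhaseRetrieval

end

/-! ### The main theorem -/

theorem mainTheorem5 (k : ℝ → ℝ → ℂ) (hk : IsKernel k) (R : H1 → EReal) (hR : IsStabilizing R)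
    (ε β : ℝ) (hε : 0 < ε) (hβ : 0 < β) :
    -- existence and stability for phase data `ψ` and amplitude data `a`
    (∀ (α : ℝ) (ψ : RealL202) (a : RealL201), 0 < α →
      (∃ f, IsMinimizer (phaseTikhonov k hk R ε β α ψ a) f) ∧
      ∀ (ψs : ℕ → RealL202) (as : ℕ → RealL201) (fs : ℕ → H1),
        Tendsto (fun n => ‖expPhase (ψs n) - expPhase ψ‖) atTop (𝓝 0) →
        Tendsto (fun n => ‖as n - a‖) atTop (𝓝 0) →
        (∀ n, IsMinimizer (phaseTikhonov k hk R ε β α (ψs n) (as n)) (fs n)) →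
        (∃ (φ : ℕ → ℕ) (f : H1), StrictMono φ ∧ WeakTendsto (fs ∘ φ) f) ∧
        ∀ (φ : ℕ → ℕ) (f : H1), StrictMono φ → WeakTendsto (fs ∘ φ) f →
          IsMinimizer (phaseTikhonov k hk R ε β α ψ a) f ∧
          Tendsto (fun n => R (fs (φ n))) atTop (𝓝 (R f))) ∧
    -- existence and stability for arbitrary data in the data space
    (∀ (α : ℝ) (y : Y) (a : RealL201), 0 < α →
      (∃ f, IsMinimizer (tikhonov k hk R ε β α y a) f) ∧
      ∀ (ys : ℕ → Y) (as : ℕ → RealL201) (fs : ℕ → H1),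
        Tendsto (fun n => ‖ys n - y‖) atTop (𝓝 0) →
        Tendsto (fun n => ‖as n - a‖) atTop (𝓝 0) →
        (∀ n, IsMinimizer (tikhonov k hk R ε β α (ys n) (as n)) (fs n)) →
        (∃ (φ : ℕ → ℕ) (f : H1), StrictMono φ ∧ WeakTendsto (fs ∘ φ) f) ∧
        ∀ (φ : ℕ → ℕ) (f : H1), StrictMono φ → WeakTendsto (fs ∘ φ) f →
          IsMinimizer (tikhonov k hk R ε β α y a) f ∧
          Tendsto (fun n => R (fs (φ n))) atTop (𝓝 (R f))) ∧
    -- convergence to `R`-minimizing solutions as the noise levels tend to zero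
    (∀ (y : Y) (a : RealL201), (∃ f, IsSolution k hk ε y a f ∧ R f ≠ ⊤) →
      (∃ f, IsRMinimizingSolution k hk R ε y a f) ∧
      ∀ (δ σ α : ℕ → ℝ) (ys : ℕ → Y) (as : ℕ → RealL201) (fs : ℕ → H1),
        (∀ n, 0 < α n) →
        Tendsto δ atTop (𝓝 0) → Tendsto σ atTop (𝓝 0) → Tendsto α atTop (𝓝 0) →
        Tendsto (fun n => (δ n ^ 2 + σ n ^ 2) / α n) atTop (𝓝 0) →
        (∀ n, ‖ys n - y‖ ≤ δ n) → (∀ n, ‖as n - a‖ ≤ σ n) →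
        (∀ n, IsMinimizer (tikhonov k hk R ε β (α n) (ys n) (as n)) (fs n)) →
        (∃ (φ : ℕ → ℕ) (f : H1), StrictMono φ ∧ WeakTendsto (fs ∘ φ) f) ∧
        (∀ (φ : ℕ → ℕ) (f : H1), StrictMono φ → WeakTendsto (fs ∘ φ) f →
          IsRMinimizingSolution k hk R ε y a f ∧
          Tendsto (fun n => R (fs (φ n))) atTop (𝓝 (R f))) ∧
        (∀ f, IsRMinimizingSolution k hk R ε y a f →
          (∀ g, IsRMinimizingSolution k hk R ε y a g → g = f) → WeakTendsto fs f)) := by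
  have hstab : ∀ (α : ℝ) (y : Y) (a : RealL201), 0 < α →
      (∃ f, IsMinimizer (tikhonov k hk R ε β α y a) f) ∧
      ∀ (ys : ℕ → Y) (as : ℕ → RealL201) (fs : ℕ → H1),
        Tendsto (fun n => ‖ys n - y‖) atTop (𝓝 0) →
        Tendsto (fun n => ‖as n - a‖) atTop (𝓝 0) →
        (∀ n, IsMinimizer (tikhonov k hk R ε β α (ys n) (as n)) (fs n)) →
        (∃ (φ : ℕ → ℕ) (f : H1), StrictMono φ ∧ WeakTendsto (fs ∘ φ) f) ∧
        ∀ (φ : ℕ → ℕ) (f : H1), StrictMono φ → WeakTendsto (fs ∘ φ) f →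
          IsMinimizer (tikhonov k hk R ε β α y a) f ∧
          Tendsto (fun n => R (fs (φ n))) atTop (𝓝 (R f)) := fun α y a hα =>
    ⟨exists_isMinimizer_tikhonov hR hε hβ hα y a,
      fun _ _ _ hy ha hfs => stability_tikhonov hR hε hβ hα hy ha hfs⟩
  refine ⟨fun α ψ a hα => ⟨(hstab α (expPhase ψ) a hα).1, fun ψs as fs =>
    (hstab α (expPhase ψ) a hα).2 (fun n => expPhase (ψs n)) as fs⟩, hstab, ?_⟩
  intro y a hsol
  refine ⟨exists_isRMinimizingSolution hR hε hsol, ?_⟩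
  intro δ σ α ys as fs hα hδ hσ hα0 hδσα hy ha hfs
  -- Index maps need only tend to infinity, since the subsequence principle below produces ones that
  -- may fail to be monotone.
  have hlim : ∀ (ns : ℕ → ℕ) (f : H1), Tendsto ns atTop atTop → WeakTendsto (fs ∘ ns) f →
      IsRMinimizingSolution k hk R ε y a f ∧
        Tendsto (fun n => R (fs (ns n))) atTop (𝓝 (R f)) := fun ns f hns h =>
    isRMinimizingSolution_of_weakTendsto hR hε hβ (fun n => hα (ns n)) (hδ.comp hns)
      (hσ.comp hns) (hα0.comp hns) (hδσα.comp hns) (fun n => hy (ns n)) (fun n => ha (ns n))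
      (fun n => hfs (ns n)) hsol h
  refine ⟨exists_subseq_of_isMinimizer hR hβ hα hδσα hy ha hfs hsol,
    fun φ f hφ h => hlim φ f hφ.tendsto_atTop h, fun f _ huniq => ?_⟩
  -- Every subsequence has a further one with a weak limit, which is a penalty-minimizing solution
  -- and hence equals `f`.
  refine tendsto_of_subseq_tendsto fun ns hns => ?_
  obtain ⟨φ, g, hφ, hg⟩ := exists_subseq_of_isMinimizer (fs := fs ∘ ns) hR hβ
    (fun n => hα (ns n)) (hδσα.comp hns) (fun n => hy (ns n)) (fun n => ha (ns n))
    (fun n => hfs (ns n)) hsol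
  have hgf := huniq g (hlim (ns ∘ φ) g (hns.comp hφ.tendsto_atTop) hg).1
  exact ⟨φ, hgf ▸ hg⟩
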